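/- Let $f(x)=\sum_{n\ge 0}a_nx^n\in\mathbb{Z}[[x]]$ be a formal power series with integer coefficients such that the set $\{a_n : n\ge 0\}$ is finite. Regard $f$ as an element of the field $\mathbb{Q}((x))$ of formal Laurent series, which contains the field of rational functions $\mathbb{Q}(x)$ through expansion at $x=0$. Then exactly one of the following holds: $f(x)\in\mathbb{Q}(x)$, or $f(x)$ is transcendental over $\mathbb{Q}(x)$. Moreover, if $f(x)\in\mathbb{Q}(x)$, then the sequence $(a_n)_{n\ge 0}$ is eventually periodic, that is, there are integers $N\ge 0$ and $T\ge 1$ such that $a_{n+T}=a_n$ for all $n\ge N$. -/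

import Mathlib

-- This makes the algebra structure of `LaurentSeries ℚ` over `RatFunc ℚ` available.
open scoped RatFunc

/-- A sequence is eventually periodic if, from some index on, it repeats with some positive
period. -/
def EventuallyPeriodic {α : Type*} (a : ℕ → α) : Prop :=
  ∃ N T : ℕ, 0 < T ∧ ∀ n, N ≤ n → a (n + T) = a n

/-- An integral power series viewed in the field `ℚ((x))` of formal Laurent series, of which the
field `ℚ(x)` of rational functions is a subfield through `algebraMap` (expansion at `0`). -/
noncomputable def PowerSeries.toRatLaurent (f : PowerSeries ℤ) : LaurentSeries ℚ :=
  HahnSeries.ofPowerSeries ℤ ℚ (PowerSeries.map (Int.castRingHom ℚ) f)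

/-- `f ∈ ℚ(x)`: the integral power series `f` is the expansion of a rational function. -/
def PowerSeries.IsRational (f : PowerSeries ℤ) : Prop :=
  ∃ r : RatFunc ℚ, algebraMap (RatFunc ℚ) (LaurentSeries ℚ) r = f.toRatLaurent

/-!
Let `θ = X * d/dX`. If a Laurent series `F` is algebraic over `K(X)`, then, `K` having
characteristic zero, `K(X)(F)` is a finite extension of `K(X)` stable under `θ`. Hence the iterates
`θ^i F` satisfy a nontrivial relation `∑ i ≤ r, c i * θ^i F = 0` with polynomials `c i` and
`c r ≠ 0`. Its coefficient at `X^n` says that the polynomial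
`P n (T) = ∑ k, F.coeff (n - k) * ∑ i, (c i).coeff k * (T - k)^i` vanishes at `T = n`. When `F` has
finitely many distinct coefficients there are only finitely many polynomials `P n`, and each nonzero
one has finitely many roots, so `P n = 0` for all but finitely many `n`. The coefficient of `T^r` in
`P n` is the coefficient of `X^n` in `c r * F`, so `c r * F` is a Laurent polynomial and `F` is
rational.

A rational `F` satisfies a linear recurrence from some index on. As its coefficients take finitely
many values, some window of consecutive coefficients recurs, and the recurrence repeats everything
that follows it.
-/

open Polynomial
open scoped LaurentSeries

theorem finite_range_pi_comp {ι κ β α : Type*} [Finite κ] {u : β → α}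
    (hu : (Set.range u).Finite) (g : ι → κ → β) :
    (Set.range fun n k ↦ u (g n k)).Finite :=
  (Set.Finite.pi' fun _ ↦ hu).subset (by rintro _ ⟨n, rfl⟩ k; exact ⟨_, rfl⟩)

section Derivation

open IntermediateField
open scoped Differential

theorem deriv_aeval_sub_mem {A B : Type*} [CommRing A] [CommRing B] [Differential B] [Algebra A B]
    {S : Subalgebra A B} (hS : ∀ a : A, (algebraMap A B a)′ ∈ S) {x : B} (hx : x ∈ S) (p : A[X]) :
    (aeval x p)′ - aeval x (derivative p) * x′ ∈ S := by
  induction p using Polynomial.induction_on' with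
  | add p q hp hq =>
    convert add_mem hp hq using 1
    simp only [map_add]
    ring
  | monomial n a =>
    convert mul_mem (pow_mem hx n) (hS a) using 1
    simp only [aeval_monomial, Derivation.leibniz, Derivation.leibniz_pow, smul_eq_mul,
      derivative_monomial, map_mul, nsmul_eq_mul, map_natCast]
    ring

variable {K L : Type*} [Field K] [Field L] [Differential L] [Algebra K L]

theorem deriv_algebraMap_mem_of_isFractionRing (A : Type*) [CommRing A] [Algebra A K] [Algebra A L]
    [IsScalarTower A K L] [IsFractionRing A K] {E : IntermediateField K L}
    (hA : ∀ a : A, (algebraMap A L a)′ ∈ E) (a : K) : (algebraMap K L a)′ ∈ E := by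
  obtain ⟨b, c, -, rfl⟩ := IsFractionRing.div_surjective (A := A) a
  have hmem (a : A) : algebraMap A L a ∈ E := by
    rw [IsScalarTower.algebraMap_apply A K L]
    exact E.algebraMap_mem _
  rw [map_div₀, ← IsScalarTower.algebraMap_apply, ← IsScalarTower.algebraMap_apply,
    Derivation.leibniz_div]
  exact mul_mem (pow_mem (inv_mem (hmem c)) 2)
    (sub_mem (mul_mem (hmem c) (hA b)) (mul_mem (hmem b) (hA c)))

variable {x : L}

theorem deriv_mem_adjoin_simple (hx : IsSeparable K x)
    (hK : ∀ a : K, (algebraMap K L a)′ ∈ K⟮x⟯) {y : L} (hy : y ∈ K⟮x⟯) : y′ ∈ K⟮x⟯ := by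
  have haeval (p : K[X]) : aeval x p ∈ K⟮x⟯ :=
    algebra_adjoin_le_adjoin K {x} (aeval_mem_adjoin_singleton K x)
  have hsub (p : K[X]) : (aeval x p)′ - aeval x (derivative p) * x′ ∈ K⟮x⟯ :=
    deriv_aeval_sub_mem (S := K⟮x⟯.toSubalgebra) hK (mem_adjoin_simple_self K x) p
  have hx' : x′ ∈ K⟮x⟯ := by
    -- Differentiating `minpoly K x` at `x` and solving for `x′`; separability makes this possible.
    have hne : aeval x (derivative (minpoly K x)) ≠ 0 :=
      hx.aeval_derivative_ne_zero (minpoly.aeval K x)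
    have h := mul_mem (inv_mem (haeval (derivative (minpoly K x)))) (neg_mem (hsub (minpoly K x)))
    rwa [minpoly.aeval, map_zero, zero_sub, neg_neg, inv_mul_cancel_left₀ hne] at h
  obtain ⟨p, rfl⟩ : y ∈ (aeval (R := K) x).range := by
    rwa [← Algebra.adjoin_singleton_eq_range_aeval,
      ← adjoin_simple_toSubalgebra_of_isAlgebraic hx.isIntegral.isAlgebraic]
  simpa using add_mem (hsub p) (mul_mem (haeval (derivative p)) hx')

theorem not_linearIndependent_iterate_deriv (hx : IsSeparable K x)
    (hK : ∀ a : K, (algebraMap K L a)′ ∈ K⟮x⟯) :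
    ¬ LinearIndependent K fun i : ℕ ↦ Differential.deriv^[i] x := by
  have hmem (i : ℕ) : Differential.deriv^[i] x ∈ K⟮x⟯ := by
    induction i with
    | zero => exact mem_adjoin_simple_self K x
    | succ i ih =>
      rw [Function.iterate_succ_apply']
      exact deriv_mem_adjoin_simple hx hK ih
  have := adjoin.finiteDimensional hx.isIntegral
  intro h
  have hE : LinearIndependent K fun i : ℕ ↦ (⟨_, hmem i⟩ : K⟮x⟯) :=
    .of_comp K⟮x⟯.val.toLinearMap h
  exact Module.Finite.not_linearIndependent_of_infinite _ hE

end Derivation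

theorem coeff_sum_range_C_mul_X_sub_C_pow {R : Type*} [CommRing R] (a : ℕ → R) (b : R) (r : ℕ) :
    (∑ i ∈ Finset.range (r + 1), C (a i) * (X - C b) ^ i).coeff r = a r := by
  have hcoeff (i : ℕ) : ((X - C b) ^ i).coeff r = (-b) ^ (i - r) * i.choose r := by
    rw [sub_eq_add_neg, ← C_neg, coeff_X_add_C_pow]
  have hlower : ∀ i ∈ Finset.range r, (C (a i) * (X - C b) ^ i).coeff r = 0 := fun i hi ↦ by
    rw [coeff_C_mul, hcoeff, Nat.choose_eq_zero_of_lt (Finset.mem_range.1 hi), Nat.cast_zero,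
      mul_zero, mul_zero]
  rw [finsetSum_coeff, Finset.sum_range_succ, Finset.sum_eq_zero hlower, coeff_C_mul, hcoeff]
  simp

theorem exists_sum_range_smul_eq_zero_of_not_linearIndependent {A M : Type*} [Ring A]
    [AddCommGroup M] [Module A M] {v : ℕ → M} (h : ¬ LinearIndependent A v) :
    ∃ (c : ℕ → A) (r : ℕ), c r ≠ 0 ∧ ∑ i ∈ Finset.range (r + 1), c i • v i = 0 := by
  obtain ⟨c, hc, hc0⟩ := not_linearIndependent_iff_finsupp.1 h
  have hs : c.support.Nonempty := Finsupp.support_nonempty_iff.2 hc0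
  refine ⟨c, c.support.max' hs, Finsupp.mem_support_iff.1 (Finset.max'_mem _ hs), ?_⟩
  rwa [← Finsupp.sum_of_support_subset c (fun i hi ↦ ?_) (fun i a ↦ a • v i) (by simp)]
  exact Finset.mem_range_succ_iff.2 (Finset.le_max' _ i hi)

section Polynomial

variable {R ι : Type*} [CommRing R] [IsDomain R] {t : ι → R}

theorem finite_setOf_ne_zero_of_eval_eq_zero (ht : t.Injective) {P : ι → R[X]}
    (hP : (Set.range P).Finite) (h : ∀ n, (P n).eval (t n) = 0) : {n | P n ≠ 0}.Finite := by
  have hroots : (⋃ p ∈ Set.range P, {n | p ≠ 0 ∧ p.eval (t n) = 0}).Finite := by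
    refine hP.biUnion fun p _ ↦ ?_
    by_cases hp : p = 0
    · simp [hp]
    · exact ((finite_setOfPred_isRoot hp).preimage ht.injOn).subset fun n hn ↦ hn.2
  exact hroots.subset fun n hn ↦ Set.mem_biUnion ⟨n, rfl⟩ ⟨hn, h n⟩

theorem finite_setOf_sum_coeff_mul_ne_zero (ht : t.Injective) {κ : Type*} [Fintype κ]
    {v : ι → κ → R} (hv : (Set.range v).Finite) {Q : κ → R[X]}
    (h : ∀ n, ∑ k, (Q k).eval (t n) * v n k = 0) (r : ℕ) :
    {n | ∑ k, (Q k).coeff r * v n k ≠ 0}.Finite := by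
  let P (n : ι) : R[X] := ∑ k, Q k * C (v n k)
  have hP : (Set.range P).Finite :=
    (hv.image fun w ↦ ∑ k, Q k * C (w k)).subset (by rintro _ ⟨n, rfl⟩; exact ⟨_, ⟨n, rfl⟩, rfl⟩)
  have heval (n : ι) : (P n).eval (t n) = 0 := by
    simpa only [P, eval_finsetSum, eval_mul, eval_C] using h n
  refine (finite_setOf_ne_zero_of_eval_eq_zero ht hP heval).subset fun n hn hPn ↦ hn ?_
  simpa only [P, finsetSum_coeff, coeff_mul_C, coeff_zero] using congrArg (coeff · r) hPn

end Polynomial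

section LaurentSeries

variable {R : Type*} [CommSemiring R]

theorem algebraMap_monomial_laurentSeries (n : ℕ) (a : R) :
    algebraMap R[X] R⸨X⸩ (monomial n a) = HahnSeries.single (n : ℤ) a := by
  rw [algebraMap_hahnSeries_apply, coe_monomial, PowerSeries.monomial_eq_C_mul_X_pow, map_mul,
    HahnSeries.ofPowerSeries_C, HahnSeries.ofPowerSeries_X_pow, HahnSeries.C_apply,
    HahnSeries.single_mul_single, zero_add, mul_one]

theorem coeff_polynomial_smul (p : R[X]) (F : R⸨X⸩) (n : ℤ) :
    (p • F).coeff n = p.sum fun k a ↦ a * F.coeff (n - k) := by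
  induction p using Polynomial.induction_on' with
  | add p q hp hq =>
    rw [add_smul, HahnSeries.coeff_add, hp, hq, sum_add_index _ _ _ (by simp)
      (by simp [add_mul])]
  | monomial k a =>
    rw [Algebra.smul_def, algebraMap_monomial_laurentSeries, HahnSeries.coeff_single_mul,
      sum_monomial_index a _ (zero_mul _)]

theorem coeff_polynomial_smul_of_natDegree_lt {p : R[X]} {D : ℕ} (hp : p.natDegree < D)
    (F : R⸨X⸩) (n : ℤ) :
    (p • F).coeff n = ∑ k : Fin D, p.coeff k * F.coeff (n - (k : ℕ)) := by
  rw [coeff_polynomial_smul, sum_over_range' p (by simp) D hp,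
    Fin.sum_univ_eq_sum_range (fun k ↦ p.coeff k * F.coeff (n - k))]

theorem finite_support_algebraMap_laurentSeries (p : R[X]) :
    (algebraMap R[X] R⸨X⸩ p).support.Finite := by
  induction p using Polynomial.induction_on' with
  | add p q hp hq =>
    rw [map_add]
    exact (hp.union hq).subset (HahnSeries.support_add_subset _ _)
  | monomial n a =>
    rw [algebraMap_monomial_laurentSeries]
    exact (Set.finite_singleton _).subset HahnSeries.support_single_subset

theorem coeff_polynomial_smul_add_natDegree (p : R[X]) (F : R⸨X⸩) (n : ℤ) :
    (p • F).coeff (n + p.natDegree) = p.reverse.sum fun i a ↦ a * F.coeff (n + i) := by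
  rw [coeff_polynomial_smul, sum_over_range p (by simp),
    sum_over_range' p.reverse (by simp) _ (Nat.lt_succ_of_le p.reverse_natDegree_le),
    ← Finset.sum_flip]
  refine Finset.sum_congr rfl fun i hi ↦ ?_
  have hi : i ≤ p.natDegree := Finset.mem_range_succ_iff.1 hi
  rw [coeff_reverse, revAt_le hi, Nat.cast_sub hi, add_sub_assoc, sub_sub_cancel]

end LaurentSeries

/-- The differential ring structure given by an additive map that satisfies the Leibniz rule.
The ring is an arbitrary one so that the derivation is linear for the canonical `ℤ`-algebra
structure: on `R⸨X⸩` instance search finds `HahnSeries.powerSeriesAlgebra` instead. -/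
@[reducible]
def differentialOfLeibniz {A : Type*} [CommRing A] (θ : A →+ A)
    (hθ : ∀ a b, θ (a * b) = a * θ b + b * θ a) : Differential A :=
  ⟨Derivation.mk' θ.toIntLinearMap hθ⟩

section Euler

open scoped Differential

variable {R : Type*} [CommRing R]

/-- The Euler operator `X * d/dX` on Laurent series, preferred to `d/dX` because its iterates
multiply the `n`-th coefficient by a power of `n` without shifting it. -/
def eulerOperator (R : Type*) [CommRing R] : R⸨X⸩ →+ R⸨X⸩ where
  toFun F := ⟨fun n ↦ n * F.coeff n, F.isPWO_support.mono fun _ hn ↦ right_ne_zero_of_mul hn⟩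
  map_zero' := by ext n; simp
  map_add' F G := by ext n; simp [mul_add]

theorem coeff_eulerOperator (F : R⸨X⸩) (n : ℤ) : (eulerOperator R F).coeff n = n * F.coeff n :=
  rfl

theorem eulerOperator_mul (F G : R⸨X⸩) :
    eulerOperator R (F * G) = F * eulerOperator R G + G * eulerOperator R F := by
  have hsupp (F : R⸨X⸩) : (eulerOperator R F).support ⊆ F.support :=
    fun _ hn ↦ right_ne_zero_of_mul hn
  ext n
  rw [mul_comm G, coeff_eulerOperator, HahnSeries.coeff_add,
    HahnSeries.coeff_mul_left' F.isPWO_support (hsupp F),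
    HahnSeries.coeff_mul_right' G.isPWO_support (hsupp G), HahnSeries.coeff_mul, Finset.mul_sum,
    ← Finset.sum_add_distrib]
  refine Finset.sum_congr rfl fun ij hij ↦ ?_
  rw [← (Finset.mem_antidiagonal.1 hij).2.2, coeff_eulerOperator, coeff_eulerOperator]
  push_cast
  ring

/-- Laurent series as a differential ring whose derivation is the Euler operator. -/
@[reducible]
noncomputable def eulerDifferential (R : Type*) [CommRing R] : Differential R⸨X⸩ :=
  differentialOfLeibniz (eulerOperator R) eulerOperator_mul

attribute [local instance] eulerDifferential

theorem coeff_eulerDeriv (F : R⸨X⸩) (n : ℤ) : (F′).coeff n = n * F.coeff n :=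
  rfl

theorem coeff_iterate_eulerDeriv (F : R⸨X⸩) (i : ℕ) (n : ℤ) :
    (Differential.deriv^[i] F).coeff n = n ^ i * F.coeff n := by
  induction i with
  | zero => simp
  | succ i ih => rw [Function.iterate_succ_apply', coeff_eulerDeriv, ih]; ring

theorem eulerDeriv_algebraMap_polynomial (p : R[X]) :
    (algebraMap R[X] R⸨X⸩ p)′ = algebraMap R[X] R⸨X⸩ (X * derivative p) := by
  induction p using Polynomial.induction_on' with
  | add p q hp hq => simp only [map_add, mul_add, hp, hq]
  | monomial n a =>
    have hX : X * derivative (monomial n a) = monomial n (n * a) := by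
      rw [derivative_monomial, X_mul_monomial]
      cases n <;> simp [mul_comm]
    ext m
    rw [hX, algebraMap_monomial_laurentSeries, algebraMap_monomial_laurentSeries, coeff_eulerDeriv,
      HahnSeries.coeff_single, HahnSeries.coeff_single]
    split_ifs with hm
    · rw [hm, Int.cast_natCast]
    · rw [mul_zero]

theorem not_linearIndependent_iterate_eulerDeriv_of_isAlgebraic {K : Type*} [Field K] [CharZero K]
    {F : K⸨X⸩} (hF : IsAlgebraic (RatFunc K) F) :
    ¬ LinearIndependent K[X] fun i : ℕ ↦ Differential.deriv^[i] F := by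
  rw [LinearIndependent.iff_fractionRing K[X] (RatFunc K)]
  refine not_linearIndependent_iterate_deriv (minpoly.irreducible hF.isIntegral).separable
    (deriv_algebraMap_mem_of_isFractionRing K[X] fun p ↦ ?_)
  rw [eulerDeriv_algebraMap_polynomial, IsScalarTower.algebraMap_apply K[X] (RatFunc K) K⸨X⸩]
  exact algebraMap_mem _ _

theorem exists_finite_support_smul_of_not_linearIndependent [IsDomain R] [CharZero R] {F : R⸨X⸩}
    (hF : (Set.range F.coeff).Finite)
    (hdep : ¬ LinearIndependent R[X] fun i : ℕ ↦ Differential.deriv^[i] F) :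
    ∃ q : R[X], q ≠ 0 ∧ (q • F).support.Finite := by
  obtain ⟨c, r, hcr, hsum⟩ := exists_sum_range_smul_eq_zero_of_not_linearIndependent hdep
  obtain ⟨D, hD⟩ : ∃ D, ∀ i ∈ Finset.range (r + 1), (c i).natDegree < D :=
    ⟨_, fun i hi ↦ Nat.lt_succ_of_le (Finset.le_sup (f := fun i ↦ (c i).natDegree) hi)⟩
  -- At `X^n` the relation reads `∑ k, Q k (n) * F.coeff (n - k) = 0`.
  let Q (k : Fin D) : R[X] :=
    ∑ i ∈ Finset.range (r + 1), C ((c i).coeff k) * (X - C (k : R)) ^ i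
  have hQ (n : ℤ) : ∑ k, (Q k).eval (n : R) * F.coeff (n - (k : ℕ)) = 0 := by
    have hn : ∑ i ∈ Finset.range (r + 1), (c i • Differential.deriv^[i] F).coeff n = 0 := by
      rw [← HahnSeries.coeff_sum, hsum, HahnSeries.coeff_zero]
    rw [← hn, Finset.sum_congr rfl fun i hi ↦ coeff_polynomial_smul_of_natDegree_lt (hD i hi) _ n,
      Finset.sum_comm]
    refine Finset.sum_congr rfl fun k _ ↦ ?_
    simp only [Q, eval_finsetSum, eval_mul, eval_pow, eval_sub, eval_X, eval_C, Finset.sum_mul,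
      coeff_iterate_eulerDeriv, Int.cast_sub, Int.cast_natCast, mul_assoc]
  refine ⟨c r, hcr, (finite_setOf_sum_coeff_mul_ne_zero Int.cast_injective
    (finite_range_pi_comp hF fun n (k : Fin D) ↦ n - (k : ℕ)) hQ r).subset fun n hn ↦ ?_⟩
  rw [HahnSeries.mem_support,
    coeff_polynomial_smul_of_natDegree_lt (hD r (Finset.self_mem_range_succ r))] at hn
  simpa only [Set.mem_ofPred_eq, Q, coeff_sum_range_C_mul_X_sub_C_pow] using hn

end Euler

theorem EventuallyPeriodic.of_isSolution {R : Type*} [CommSemiring R] {E : LinearRecurrence R}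
    {u : ℕ → R} (hE : E.IsSolution u) (hu : (Set.range u).Finite) : EventuallyPeriodic u := by
  have hfin := finite_range_pi_comp hu fun n (i : Fin E.order) ↦ n + (i : ℕ)
  obtain ⟨m, n, hmn, hwindow⟩ := hfin.exists_lt_map_eq_of_forall_mem Set.mem_range_self
  have hshift (a : ℕ) : E.IsSolution fun k ↦ u (a + k) := fun k ↦ by
    simpa only [add_assoc] using hE (a + k)
  have heq : (fun k ↦ u (m + k)) = fun k ↦ u (n + k) :=
    (E.eq_iff_eqOn_range_order _ _ (hshift m) (hshift n)).2 fun i hi ↦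
      congrFun hwindow ⟨i, Finset.mem_range.1 hi⟩
  refine ⟨m, n - m, by omega, fun k hk ↦ ?_⟩
  have hk' : u (m + (k - m)) = u (n + (k - m)) := congrFun heq (k - m)
  rw [show m + (k - m) = k by omega, show n + (k - m) = k + (n - m) by omega] at hk'
  exact hk'.symm

theorem EventuallyPeriodic.of_shift {α : Type*} {u : ℕ → α} {N : ℕ}
    (h : EventuallyPeriodic fun n ↦ u (N + n)) : EventuallyPeriodic u := by
  obtain ⟨M, T, hT, hM⟩ := h
  refine ⟨N + M, T, hT, fun n hn ↦ ?_⟩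
  obtain ⟨k, rfl⟩ := Nat.exists_eq_add_of_le hn
  simpa only [add_assoc] using hM (M + k) (by omega)

theorem EventuallyPeriodic.of_comp {α β : Type*} {u : ℕ → α} {φ : α → β} (hφ : φ.Injective)
    (h : EventuallyPeriodic (φ ∘ u)) : EventuallyPeriodic u := by
  obtain ⟨N, T, hT, hN⟩ := h
  exact ⟨N, T, hT, fun n hn ↦ hφ (hN n hn)⟩

theorem exists_isSolution_of_sum_eq_zero {K : Type*} [Field K] {p : K[X]} (hp : p ≠ 0) {u : ℕ → K}
    (h : ∀ n, (p.sum fun i a ↦ a * u (n + i)) = 0) : ∃ E : LinearRecurrence K, E.IsSolution u := by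
  refine ⟨⟨p.natDegree, fun i ↦ -(p.coeff i / p.leadingCoeff)⟩, fun n ↦ ?_⟩
  have hlead : p.leadingCoeff ≠ 0 := leadingCoeff_ne_zero.2 hp
  have hn : ∑ i : Fin p.natDegree, p.coeff i * u (n + i) +
      p.leadingCoeff * u (n + p.natDegree) = 0 := by
    rw [← h n, sum_over_range p (by simp), Finset.sum_range_succ, coeff_natDegree,
      Fin.sum_univ_eq_sum_range fun i ↦ p.coeff i * u (n + i)]
  refine mul_left_cancel₀ hlead ?_
  rw [Finset.mul_sum, eq_neg_of_add_eq_zero_right hn, ← Finset.sum_neg_distrib]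
  refine Finset.sum_congr rfl fun i _ ↦ ?_
  field_simp

section RationalFunctions

variable {K : Type*} [Field K] {F : K⸨X⸩}

theorem single_mem_fieldRange_ratFunc (n : ℤ) (a : K) :
    HahnSeries.single n a ∈ (algebraMap (RatFunc K) K⸨X⸩).fieldRange := by
  refine ⟨algebraMap _ _ (C a) * RatFunc.X ^ n, ?_⟩
  rw [map_mul, map_zpow₀, RatFunc.coe_X, ← RatFunc.single_zpow, ← IsScalarTower.algebraMap_apply,
    ← monomial_zero_left, algebraMap_monomial_laurentSeries, HahnSeries.single_mul_single]
  simp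

theorem mem_fieldRange_ratFunc_of_finite_support (hF : F.support.Finite) :
    F ∈ (algebraMap (RatFunc K) K⸨X⸩).fieldRange := by
  have hsum : F = ∑ n ∈ hF.toFinset, HahnSeries.single n (F.coeff n) := by
    ext m
    rw [HahnSeries.coeff_sum,
      Finset.sum_eq_single m (fun n _ hnm ↦ HahnSeries.coeff_single_of_ne hnm.symm) (by simp),
      HahnSeries.coeff_single_same]
  rw [hsum]
  exact sum_mem fun n _ ↦ single_mem_fieldRange_ratFunc n _

theorem mem_fieldRange_ratFunc_iff_exists_finite_support_smul :
    F ∈ (algebraMap (RatFunc K) K⸨X⸩).fieldRange ↔ ∃ q : K[X], q ≠ 0 ∧ (q • F).support.Finite := by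
  constructor
  · rintro ⟨r, rfl⟩
    refine ⟨r.denom, r.denom_ne_zero, ?_⟩
    convert finite_support_algebraMap_laurentSeries r.num
    rw [Algebra.smul_def, IsScalarTower.algebraMap_apply K[X] (RatFunc K) K⸨X⸩,
      IsScalarTower.algebraMap_apply K[X] (RatFunc K) K⸨X⸩, ← map_mul]
    congr 1
    nth_rw 2 [← r.num_div_denom]
    exact mul_div_cancel₀ _ (RatFunc.algebraMap_ne_zero r.denom_ne_zero)
  · rintro ⟨q, hq, hqF⟩
    have hq' : algebraMap K[X] K⸨X⸩ q ≠ 0 :=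
      (map_ne_zero_iff _ (FaithfulSMul.algebraMap_injective _ _)).2 hq
    obtain ⟨s, hs⟩ := mem_fieldRange_ratFunc_of_finite_support hqF
    refine ⟨s / algebraMap _ _ q, ?_⟩
    rw [map_div₀, hs, Algebra.smul_def, ← IsScalarTower.algebraMap_apply,
      mul_div_cancel_left₀ _ hq']

theorem eventuallyPeriodic_coeff_of_finite_support_smul (hF : (Set.range F.coeff).Finite)
    {q : K[X]} (hq : q ≠ 0) (hqF : (q • F).support.Finite) :
    EventuallyPeriodic fun n : ℕ ↦ F.coeff n := by
  obtain ⟨N, hN⟩ : ∃ N : ℕ, ∀ n : ℤ, N ≤ n → (q • F).coeff n = 0 := by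
    obtain ⟨b, hb⟩ := hqF.bddAbove
    refine ⟨(b + 1).toNat, fun n hn ↦ by_contra fun hne ↦ ?_⟩
    have := hb hne
    omega
  obtain ⟨E, hE⟩ := exists_isSolution_of_sum_eq_zero (u := fun n ↦ F.coeff (N + n : ℕ))
    (reverse_eq_zero.not.2 hq) fun n ↦ by
      rw [← hN (N + n + q.natDegree) (by omega), coeff_polynomial_smul_add_natDegree]
      push_cast
      simp only [add_assoc]
  have hu : (Set.range fun n : ℕ ↦ F.coeff (N + n : ℕ)).Finite :=
    hF.subset (by rintro _ ⟨n, rfl⟩; exact ⟨_, rfl⟩)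
  exact .of_shift (.of_isSolution hE hu)

end RationalFunctions

theorem finite_range_coeff_toRatLaurent {f : PowerSeries ℤ}
    (hf : (Set.range fun n : ℕ ↦ PowerSeries.coeff n f).Finite) :
    (Set.range f.toRatLaurent.coeff).Finite := by
  refine ((hf.image (Int.cast : ℤ → ℚ)).insert 0).subset ?_
  rintro _ ⟨n, rfl⟩
  rw [PowerSeries.toRatLaurent, PowerSeries.coeff_coe]
  split_ifs with hn
  · exact .inl rfl
  · exact .inr ⟨_, ⟨_, rfl⟩, by rw [PowerSeries.coeff_map, eq_intCast]⟩

theorem coeff_natCast_toRatLaurent (f : PowerSeries ℤ) (n : ℕ) :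
    f.toRatLaurent.coeff n = PowerSeries.coeff n f := by
  rw [PowerSeries.toRatLaurent, LaurentSeries.coeff_coe_powerSeries, PowerSeries.coeff_map,
    eq_intCast]

theorem mainTheorem7_general {K : Type*} [Field K] [CharZero K] {F : K⸨X⸩}
    (hF : (Set.range F.coeff).Finite) :
    Xor (F ∈ (algebraMap (RatFunc K) K⸨X⸩).fieldRange) (Transcendental (RatFunc K) F) ∧
      (F ∈ (algebraMap (RatFunc K) K⸨X⸩).fieldRange →
        EventuallyPeriodic fun n : ℕ ↦ F.coeff n) := by
  have halg : F ∈ (algebraMap (RatFunc K) K⸨X⸩).fieldRange ↔ IsAlgebraic (RatFunc K) F := by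
    refine ⟨?_, fun h ↦ mem_fieldRange_ratFunc_iff_exists_finite_support_smul.2 ?_⟩
    · rintro ⟨r, rfl⟩
      exact isAlgebraic_algebraMap r
    · exact exists_finite_support_smul_of_not_linearIndependent hF
        (not_linearIndependent_iterate_eulerDeriv_of_isAlgebraic h)
  refine ⟨?_, fun h ↦ ?_⟩
  · rw [halg, Transcendental, xor_not_right]
  · obtain ⟨q, hq, hqF⟩ := mem_fieldRange_ratFunc_iff_exists_finite_support_smul.1 h
    exact eventuallyPeriodic_coeff_of_finite_support_smul hF hq hqF

theorem mainTheorem7 (f : PowerSeries ℤ)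
    (hf : (Set.range fun n : ℕ => PowerSeries.coeff n f).Finite) :
    Xor f.IsRational (Transcendental (RatFunc ℚ) f.toRatLaurent) ∧
      (f.IsRational → EventuallyPeriodic fun n : ℕ => PowerSeries.coeff n f) := by
  obtain ⟨hxor, hper⟩ := mainTheorem7_general (finite_range_coeff_toRatLaurent hf)
  refine ⟨hxor, fun h ↦ .of_comp (Int.cast_injective (α := ℚ)) ?_⟩
  simpa only [Function.comp_def, coeff_natCast_toRatLaurent] using hper h
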